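/- Let $\mathcal M_2$ be the real vector space of Hermitian $2\times 2$ matrices, identified with $\mathbb R^{4}$ through $\rho=\tfrac12(x_0 I+x_1\sigma_1+x_2\sigma_2+x_3\sigma_3)$, so that $\operatorname{Tr}\rho=x_0$ and $4\det\rho=\mathbf x\cdot\mathbf x:=x_0^2-x_1^2-x_2^2-x_3^2$; put $\eta=\operatorname{diag}(1,-1,-1,-1)$. Let $\Phi:\mathcal M_2\to\mathcal M_2$ be a linear map that is positive (it maps positive semidefinite matrices to positive semidefinite matrices) and trace-preserving. For $w\in\mathbb R$ let $q_w(\rho)=4(\det\Phi(\rho)-w\det\rho)$, and let $Q_w=Q_0-w\,\eta$ be the symmetric $4\times4$ matrix of the quadratic form $q_w$ in the coordinates $x_0,\dots,x_3$. States are the positive semidefinite $\rho\in\mathcal M_2$ with $\operatorname{Tr}\rho=1$; pure states are $\pi=|\psi\rangle\langle\psi|$ with $\|\psi\|=1$. The $\Phi$-concurrence of a state $\rho$ is $C_\Phi(\rho)=\inf\sum_j p_j\,2\sqrt{\det\Phi(\pi_j)}$, the infimum being over all finite decompositions $\rho=\sum_j p_j\pi_j$ into pure states $\pi_j$ with $p_j>0$,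 $\sum_j p_j=1$; such a decomposition is called optimal if $C_\Phi(\rho)=\sum_j p_jC_\Phi(\pi_j)$. Theorem. There is a unique $w_0\in\mathbb R$ such that $Q_{w_0}$ is positive semidefinite and degenerate and its kernel contains a nonzero vector $\mathbf n$ that is space-like or light-like, i.e. $\mathbf n\cdot\mathbf n\le 0$. All four eigenvalues of $\eta Q_0$, counted with algebraic multiplicity, are real, and $w_0$ is the second largest of them. Moreover: 1. $C_\Phi(\rho)=\sqrt{q_{w_0}(\rho)}$ for every state $\rho$. 2. $C_\Phi$ is a convex roof: it is convex on the set of states, and every state has an optimal decomposition. 3. $C_\Phi$ is linear along a bundle of lines. For every nonzero $\mathbf n\in\ker Q_{w_0}$ with $\mathbf n\cdot\mathbf n\le0$, regarded as an element of $\mathcal M_2$: if $n_0=0$, then $C_\Phi(\rho+s\mathbf n)=C_\Phi(\rho)$ for all $s\in\mathbb R$ and all states $\rho$ for which $\rho+s\mathbf n$ is a state; if $n_0=1$ (which can be arranged by scaling whenever $n_0\neq0$), then $C_\Phi(s\rho+(1-s)\mathbf n)=s\,C_\Phi(\rho)$ for all $s\ge0$ and all states $\rho$ for which $s\rho+(1-s)\mathbf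 n$ is a state. 4. Every state $\rho$ has an optimal decomposition with two components, $\rho=p_1\pi_1+p_2\pi_2$ (with $\pi_1=\pi_2$ allowed, which occurs exactly when $\rho$ is pure). -/

import Mathlib

open Matrix
open scoped ComplexOrder

/-- The real vector space of Hermitian `2 × 2` matrices. -/
abbrev Herm2 : Type := selfAdjoint (Matrix (Fin 2) (Fin 2) ℂ)

namespace Herm2

/-- The determinant of a Hermitian matrix, as a real number. -/
noncomputable def det (ρ : Herm2) : ℝ := (Matrix.det (ρ : Matrix (Fin 2) (Fin 2) ℂ)).re

/-- The trace of a Hermitian matrix, as a real number. -/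
noncomputable def tr (ρ : Herm2) : ℝ := (Matrix.trace (ρ : Matrix (Fin 2) (Fin 2) ℂ)).re

/-- Positive semidefinite Hermitian matrices. -/
def Nonneg (ρ : Herm2) : Prop := (ρ : Matrix (Fin 2) (Fin 2) ℂ).PosSemidef

/-- Density operators of a qubit. -/
def IsState (ρ : Herm2) : Prop := ρ.Nonneg ∧ ρ.tr = 1

/-- Pure states: `ρ = |ψ⟩⟨ψ|` for a unit vector `ψ`. -/
def IsPure (ρ : Herm2) : Prop :=
  ∃ ψ : Fin 2 → ℂ, star ψ ⬝ᵥ ψ = 1 ∧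
    (ρ : Matrix (Fin 2) (Fin 2) ℂ) = Matrix.vecMulVec ψ (star ψ)

/-- The Hermitian matrix `(x₀ I + x₁ σ₁ + x₂ σ₂ + x₃ σ₃) / 2`. -/
noncomputable def ofCoord (x : Fin 4 → ℝ) : Herm2 :=
  ⟨!![((x 0 + x 3 : ℝ) : ℂ) / 2, ((x 1 : ℂ) - Complex.I * (x 2 : ℂ)) / 2;
      ((x 1 : ℂ) + Complex.I * (x 2 : ℂ)) / 2, ((x 0 - x 3 : ℝ) : ℂ) / 2], by
    rw [selfAdjoint.mem_iff, Matrix.star_eq_conjTranspose]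
    ext i j
    fin_cases i <;> fin_cases j <;> simp [sub_eq_add_neg]⟩

end Herm2

/-- Positive real-linear maps on the Hermitian `2 × 2` matrices. -/
def IsPositiveMap (Φ : Herm2 →ₗ[ℝ] Herm2) : Prop :=
  ∀ ρ : Herm2, ρ.Nonneg → (Φ ρ).Nonneg

/-- Trace-preserving real-linear maps on the Hermitian `2 × 2` matrices. -/
def IsTracePreserving (Φ : Herm2 →ₗ[ℝ] Herm2) : Prop :=
  ∀ ρ : Herm2, (Φ ρ).tr = ρ.tr

/-- The Minkowski metric `η = diag(1, -1, -1, -1)`. -/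
def minkowskiMetric : Matrix (Fin 4) (Fin 4) ℝ := Matrix.diagonal ![1, -1, -1, -1]

/-- The Minkowski square `x · x = x₀² - x₁² - x₂² - x₃²`. -/
def minkowskiSq (x : Fin 4 → ℝ) : ℝ := x 0 ^ 2 - x 1 ^ 2 - x 2 ^ 2 - x 3 ^ 2

/-- The quadratic form `q_w(ρ) = 4 (det Φ(ρ) - w det ρ)`. -/
noncomputable def qForm (Φ : Herm2 →ₗ[ℝ] Herm2) (w : ℝ) (ρ : Herm2) : ℝ :=
  4 * ((Φ ρ).det - w * ρ.det)

/-- The symmetric matrix `Q_w` of the quadratic form `q_w` in the coordinates `x₀, x₁, x₂, x₃`,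
obtained by polarization. -/
noncomputable def qMatrix (Φ : Herm2 →ₗ[ℝ] Herm2) (w : ℝ) : Matrix (Fin 4) (Fin 4) ℝ :=
  Matrix.of fun i j =>
    QuadraticMap.polar (fun x : Fin 4 → ℝ => qForm Φ w (Herm2.ofCoord x))
      (Pi.single i 1) (Pi.single j 1) / 2

/-- `n` is a nonzero kernel vector of `Q_w` that is space-like or light-like. -/
def IsNonTimelikeKernelVector (Φ : Herm2 →ₗ[ℝ] Herm2) (w : ℝ) (n : Fin 4 → ℝ) : Prop :=
  n ≠ 0 ∧ qMatrix Φ w *ᵥ n = 0 ∧ minkowskiSq n ≤ 0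

/-- `Q_w` is positive semidefinite and degenerate, and its kernel contains a nonzero vector that is
space-like or light-like. -/
def IsAdmissibleParameter (Φ : Herm2 →ₗ[ℝ] Herm2) (w : ℝ) : Prop :=
  (qMatrix Φ w).PosSemidef ∧ (qMatrix Φ w).det = 0 ∧ ∃ n, IsNonTimelikeKernelVector Φ w n

/-- `ρ = ∑ j, p j • π j` is a convex decomposition of `ρ` into finitely many pure states, with
strictly positive weights. -/
def IsPureDecomposition (ρ : Herm2) {k : ℕ} (p : Fin k → ℝ) (π : Fin k → Herm2) : Prop :=
  (∀ j, 0 < p j) ∧ ∑ j, p j = 1 ∧ (∀ j, (π j).IsPure) ∧ ρ = ∑ j, p j • π j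

/-- The `Φ`-concurrence: the infimum of `∑ j, p j * (2 * √(det Φ(π j)))` over all finite convex
decompositions `ρ = ∑ j, p j • π j` into pure states. -/
noncomputable def concurrence (Φ : Herm2 →ₗ[ℝ] Herm2) (ρ : Herm2) : ℝ :=
  sInf {c : ℝ | ∃ (k : ℕ) (p : Fin k → ℝ) (π : Fin k → Herm2),
    IsPureDecomposition ρ p π ∧ c = ∑ j, p j * (2 * √((Φ (π j)).det))}

/-- `π₀, …, π_{k-1}` with weights `p` is a `G`-optimal decomposition of `ρ`. -/
def IsOptimalDecomposition (G : Herm2 → ℝ) (ρ : Herm2) {k : ℕ} (p : Fin k → ℝ)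
    (π : Fin k → Herm2) : Prop :=
  IsPureDecomposition ρ p π ∧ G ρ = ∑ j, p j * G (π j)

/-- `G` is a convex roof on the state space: it is convex there, and every state has a `G`-optimal
decomposition. -/
def IsConvexRoof (G : Herm2 → ℝ) : Prop :=
  ConvexOn ℝ {ρ : Herm2 | ρ.IsState} G ∧
    ∀ ρ : Herm2, ρ.IsState →
      ∃ (k : ℕ) (p : Fin k → ℝ) (π : Fin k → Herm2), IsOptimalDecomposition G ρ p π

/-!
In Minkowski coordinates, `4 det ρ` is the Minkowski square, states are the points of the Bloch ball
`x₀ = 1`, `x · x ≥ 0`, and pure states are the points of its boundary sphere, where `q_w` does not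
depend on `w`. Positivity of `Φ` says that `Q₀` is nonnegative on the light cone.

If `Q_w` is positive semidefinite, then `√q_w` is a seminorm, so that by the triangle inequality it
is a lower bound of the concurrence. If moreover `Q_w` annihilates a nonzero vector `n` that is not
time-like, then the seminorm is linear along the line from a state towards `n`, as long as the line
does not pass beyond `n`. As `n` lies outside the open Bloch ball, the chord cut out of the ball by
this line yields a decomposition into two pure states with equality (`exists_null_decomposition`,
`exists_pureDecomposition_norm_eq`). Hence `√q_w` is the concurrence (`concurrence_eq`), and its
convexity and its linearity along the lines are those of a seminorm that vanishes at `n`.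

The parameter is the supremum of the quotients `Q₀(y) / (y · y)` over space-like `y`, which by a
form of the S-lemma is at most every such quotient at a time-like vector
(`spacelike_quotient_le_timelike_quotient`); the kernel vector comes from compactness
(`exists_posSemidef_pencil`), and uniqueness from the fact that two members of the pencil with
a common kernel vector differ by a multiple of `η`
(`minkowskiSq_pos_of_mem_ker_pencil_of_lt`). Since `η Q₀ = w + η Q_w`, the spectrum of `η Q₀` is that
of the symmetric matrix `√Q_w η √Q_w`, shifted by `w`. This matrix is singular with at most one
positive eigenvalue, and if it has none, then zero is a multiple eigenvalue
(`exists_charpoly_minkowskiMetric_mul`).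
-/

/-! ### Minkowski coordinates -/

namespace Herm2

/-- The Minkowski coordinates `x₀, …, x₃` of a Hermitian matrix. -/
noncomputable def coord (ρ : Herm2) : Fin 4 → ℝ :=
  ![(ρ.1 0 0).re + (ρ.1 1 1).re, 2 * (ρ.1 1 0).re, 2 * (ρ.1 1 0).im,
    (ρ.1 0 0).re - (ρ.1 1 1).re]

lemma coord_ofCoord (x : Fin 4 → ℝ) : coord (ofCoord x) = x := by
  ext i
  fin_cases i <;> simp [coord, ofCoord] <;> ring

lemma ofCoord_coord (ρ : Herm2) : ofCoord (coord ρ) = ρ := by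
  have h : ∀ i j, star (ρ.1 j i) = ρ.1 i j := fun i j => congrFun (congrFun ρ.2 i) j
  have h00 : (ρ.1 0 0).im = 0 := by
    have := congrArg Complex.im (h 0 0); simp at this; linarith
  have h11 : (ρ.1 1 1).im = 0 := by
    have := congrArg Complex.im (h 1 1); simp at this; linarith
  have hr := congrArg Complex.re (h 0 1)
  have hi := congrArg Complex.im (h 0 1)
  simp at hr hi
  apply Subtype.ext
  ext i j
  fin_cases i <;> fin_cases j <;> apply Complex.ext <;>
    simp [coord, ofCoord, h00, h11, hr, ← hi]
  ring

/-- The identification of the Hermitian matrices with `ℝ⁴` by `ofCoord`, as a linear equivalence. -/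
noncomputable def coordEquiv : (Fin 4 → ℝ) ≃ₗ[ℝ] Herm2 where
  toFun := ofCoord
  invFun := coord
  left_inv := coord_ofCoord
  right_inv := ofCoord_coord
  map_add' x y := by
    apply Subtype.ext
    ext i j
    fin_cases i <;> fin_cases j <;> simp [ofCoord] <;> ring
  map_smul' c x := by
    apply Subtype.ext
    ext i j
    fin_cases i <;> fin_cases j <;> simp [ofCoord] <;> ring

@[simp] lemma coordEquiv_apply (x : Fin 4 → ℝ) : coordEquiv x = ofCoord x := rfl

@[simp] lemma coordEquiv_symm_apply (ρ : Herm2) : coordEquiv.symm ρ = coord ρ := rfl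

lemma ofCoord_surjective (ρ : Herm2) : ∃ x, ofCoord x = ρ := ⟨_, ofCoord_coord ρ⟩

lemma tr_ofCoord (x : Fin 4 → ℝ) : (ofCoord x).tr = x 0 := by
  simp [tr, ofCoord, Matrix.trace_fin_two]
  ring

lemma matrix_det_ofCoord (x : Fin 4 → ℝ) :
    Matrix.det (ofCoord x).1 = ((minkowskiSq x / 4 : ℝ) : ℂ) := by
  simp only [ofCoord, Matrix.det_fin_two_of, minkowskiSq]
  push_cast
  linear_combination (x 2 : ℂ) ^ 2 / 4 * Complex.I_sq

lemma det_ofCoord (x : Fin 4 → ℝ) : (ofCoord x).det = minkowskiSq x / 4 := by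
  rw [det, matrix_det_ofCoord, Complex.ofReal_re]

/-- A Hermitian matrix is positive semidefinite if and only if it lies in the closed forward light
cone: its two eigenvalues have sum `x₀` and product `(x · x) / 4`. -/
lemma nonneg_ofCoord_iff (x : Fin 4 → ℝ) :
    (ofCoord x).Nonneg ↔ 0 ≤ x 0 ∧ 0 ≤ minkowskiSq x := by
  have hH : (ofCoord x).1.IsHermitian := (ofCoord x).2
  have htr : hH.eigenvalues 0 + hH.eigenvalues 1 = x 0 := by
    have h := congrArg Complex.re hH.trace_eq_sum_eigenvalues
    rw [show (Matrix.trace (ofCoord x).1).re = x 0 from tr_ofCoord x] at h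
    simpa using h.symm
  have hdet : hH.eigenvalues 0 * hH.eigenvalues 1 = minkowskiSq x / 4 := by
    have h := congrArg Complex.re hH.det_eq_prod_eigenvalues
    rw [matrix_det_ofCoord, Fin.prod_univ_two, Complex.ofReal_re] at h
    simpa using h.symm
  rw [Nonneg, hH.posSemidef_iff_eigenvalues_nonneg, Pi.le_def]
  simp only [Fin.forall_fin_two, Pi.zero_apply]
  constructor
  · rintro ⟨h0, h1⟩
    have := mul_nonneg h0 h1
    constructor <;> linarith
  · rintro ⟨h0, h1⟩
    constructor <;> by_contra! h <;> nlinarith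

lemma isState_ofCoord_iff (x : Fin 4 → ℝ) :
    (ofCoord x).IsState ↔ x 0 = 1 ∧ 0 ≤ minkowskiSq x := by
  rw [IsState, nonneg_ofCoord_iff, tr_ofCoord]
  constructor
  · rintro ⟨⟨-, h⟩, h0⟩
    exact ⟨h0, h⟩
  · rintro ⟨h0, h⟩
    exact ⟨⟨by linarith, h⟩, h0⟩

/-- The pure states are the points of the Bloch sphere. -/
lemma isPure_ofCoord_iff (x : Fin 4 → ℝ) :
    (ofCoord x).IsPure ↔ x 0 = 1 ∧ minkowskiSq x = 0 := by
  constructor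
  · rintro ⟨ψ, hψ, h⟩
    constructor
    · rw [← tr_ofCoord x, tr, h, Matrix.trace_vecMulVec, dotProduct_comm, hψ, Complex.one_re]
    · have hd := matrix_det_ofCoord x
      rw [h, Matrix.det_fin_two] at hd
      simp only [Matrix.vecMulVec_apply] at hd
      have : ((minkowskiSq x / 4 : ℝ) : ℂ) = 0 := by rw [← hd]; ring
      have := Complex.ofReal_eq_zero.mp this
      linarith
  · rintro ⟨h0, hx⟩
    rw [minkowskiSq, h0] at hx
    by_cases h3 : x 3 = -1
    · have h1 : x 1 = 0 := by nlinarith [sq_nonneg (x 2)]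
      have h2 : x 2 = 0 := by nlinarith [sq_nonneg (x 1)]
      refine ⟨![0, 1], by simp [dotProduct, Fin.sum_univ_two], ?_⟩
      ext i j
      fin_cases i <;> fin_cases j <;> simp [ofCoord, h0, h1, h2, h3, Matrix.vecMulVec_apply]
    · have hpos : 0 < (1 + x 3) / 2 := by
        have : -1 ≤ x 3 := by nlinarith [sq_nonneg (x 1), sq_nonneg (x 2)]
        have := lt_of_le_of_ne this (Ne.symm h3)
        linarith
      obtain ⟨a, ha, ha2⟩ : ∃ a : ℝ, 0 < a ∧ a ^ 2 = (1 + x 3) / 2 :=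
        ⟨√((1 + x 3) / 2), Real.sqrt_pos.mpr hpos, Real.sq_sqrt hpos.le⟩
      have hb : x 1 / (2 * a) * (x 1 / (2 * a)) + x 2 / (2 * a) * (x 2 / (2 * a))
          = (1 - x 3) / 2 := by
        field_simp
        rw [ha2]
        linarith
      have hae : a * a = (1 + x 3) / 2 := by rw [← ha2]; ring
      refine ⟨![(a : ℂ), ⟨x 1 / (2 * a), x 2 / (2 * a)⟩], ?_, ?_⟩
      · apply Complex.ext
        · simp [dotProduct, Fin.sum_univ_two]
          linarith
        · simp [dotProduct, Fin.sum_univ_two]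
          ring
      · have e1 : a * (x 1 / (2 * a)) = x 1 / 2 := by field_simp
        have e2 : a * (x 2 / (2 * a)) = x 2 / 2 := by field_simp
        ext i j
        fin_cases i <;> fin_cases j <;> apply Complex.ext <;>
          simp [ofCoord, h0, Matrix.vecMulVec_apply] <;> linarith

end Herm2

/-! ### The quadratic form in coordinates -/

lemma minkowskiSq_eq (x : Fin 4 → ℝ) : minkowskiSq x = x ⬝ᵥ (minkowskiMetric *ᵥ x) := by
  simp [minkowskiSq, minkowskiMetric, Matrix.mulVec_diagonal, dotProduct, Fin.sum_univ_four]
  ring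

lemma minkowskiMetric_isHermitian : minkowskiMetric.IsHermitian := by
  simp [minkowskiMetric]

lemma minkowskiMetric_mul_self : minkowskiMetric * minkowskiMetric = 1 := by
  rw [minkowskiMetric, Matrix.diagonal_mul_diagonal, ← Matrix.diagonal_one]
  congr 1
  ext i
  fin_cases i <;> simp

/-- For a symmetric matrix the form `x ↦ x ⬝ᵥ M *ᵥ x` is expanded along `x + t • y`. -/
lemma dotProduct_mulVec_add_smul {n : Type*} [Fintype n] {M : Matrix n n ℝ} (hM : M.IsHermitian)
    (x y : n → ℝ) (t : ℝ) :
    (x + t • y) ⬝ᵥ (M *ᵥ (x + t • y)) =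
      x ⬝ᵥ (M *ᵥ x) + 2 * t * (x ⬝ᵥ (M *ᵥ y)) + t ^ 2 * (y ⬝ᵥ (M *ᵥ y)) := by
  have h : y ⬝ᵥ (M *ᵥ x) = x ⬝ᵥ (M *ᵥ y) := by
    rw [dotProduct_comm, dotProduct_mulVec, ← Matrix.mulVec_transpose,
      show Mᵀ = M by simpa [conjTranspose_eq_transpose_of_trivial] using hM.eq]
  simp only [mulVec_add, mulVec_smul, dotProduct_add, add_dotProduct, smul_dotProduct,
    dotProduct_smul, smul_eq_mul, h]
  ring

/-- The matrix of a linear map `Φ` in Minkowski coordinates. -/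
noncomputable def coordMatrix (Φ : Herm2 →ₗ[ℝ] Herm2) : Matrix (Fin 4) (Fin 4) ℝ :=
  LinearMap.toMatrix'
    (Herm2.coordEquiv.symm.toLinearMap ∘ₗ Φ ∘ₗ Herm2.coordEquiv.toLinearMap)

lemma map_ofCoord (Φ : Herm2 →ₗ[ℝ] Herm2) (x : Fin 4 → ℝ) :
    Φ (Herm2.ofCoord x) = Herm2.ofCoord (coordMatrix Φ *ᵥ x) := by
  rw [coordMatrix, ← Matrix.toLin'_apply, Matrix.toLin'_toMatrix']
  simp [Herm2.ofCoord_coord]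

lemma qForm_ofCoord_eq (Φ : Herm2 →ₗ[ℝ] Herm2) (w : ℝ) (x : Fin 4 → ℝ) :
    qForm Φ w (Herm2.ofCoord x) =
      x ⬝ᵥ (((coordMatrix Φ)ᵀ * minkowskiMetric * coordMatrix Φ - w • minkowskiMetric) *ᵥ x) := by
  rw [qForm, map_ofCoord, Herm2.det_ofCoord, Herm2.det_ofCoord, minkowskiSq_eq, minkowskiSq_eq,
    sub_mulVec, dotProduct_sub, smul_mulVec, dotProduct_smul, smul_eq_mul,
    ← mulVec_mulVec, ← mulVec_mulVec, dotProduct_mulVec x (coordMatrix Φ)ᵀ, vecMul_transpose]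
  ring

lemma qMatrix_eq (Φ : Herm2 →ₗ[ℝ] Herm2) (w : ℝ) :
    qMatrix Φ w = (coordMatrix Φ)ᵀ * minkowskiMetric * coordMatrix Φ - w • minkowskiMetric := by
  set M := (coordMatrix Φ)ᵀ * minkowskiMetric * coordMatrix Φ - w • minkowskiMetric with hMdef
  have hM : M.IsHermitian := by
    refine IsHermitian.sub ?_ ?_
    · rw [← conjTranspose_eq_transpose_of_trivial]
      exact isHermitian_conjTranspose_mul_mul _ minkowskiMetric_isHermitian
    · rw [IsHermitian, conjTranspose_smul, minkowskiMetric_isHermitian.eq, star_trivial]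
  ext i j
  have h := dotProduct_mulVec_add_smul hM (Pi.single i 1) (Pi.single j 1) 1
  rw [qMatrix, of_apply, QuadraticMap.polar]
  simp only [qForm_ofCoord_eq, ← hMdef]
  rw [one_smul] at h
  rw [h]
  simp
  ring

lemma qMatrix_isHermitian (Φ : Herm2 →ₗ[ℝ] Herm2) (w : ℝ) : (qMatrix Φ w).IsHermitian := by
  ext i j
  rw [conjTranspose_apply, qMatrix, of_apply, of_apply, QuadraticMap.polar_comm, star_trivial]

lemma qForm_ofCoord (Φ : Herm2 →ₗ[ℝ] Herm2) (w : ℝ) (x : Fin 4 → ℝ) :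
    qForm Φ w (Herm2.ofCoord x) = x ⬝ᵥ (qMatrix Φ w *ᵥ x) := by
  rw [qForm_ofCoord_eq, qMatrix_eq]

lemma qMatrix_eq_sub (Φ : Herm2 →ₗ[ℝ] Herm2) (w : ℝ) :
    qMatrix Φ w = qMatrix Φ 0 - w • minkowskiMetric := by
  simp [qMatrix_eq]

/-- For a positive map, `Q₀` is nonnegative on the light cone. -/
lemma dotProduct_qMatrix_mulVec_nonneg {Φ : Herm2 →ₗ[ℝ] Herm2} (hpos : IsPositiveMap Φ)
    {x : Fin 4 → ℝ} (hx : minkowskiSq x = 0) : 0 ≤ x ⬝ᵥ (qMatrix Φ 0 *ᵥ x) := by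
  -- Up to sign, `x` is a rank one positive operator, which `Φ` maps to a positive operator.
  have key : ∀ y : Fin 4 → ℝ, 0 ≤ y 0 → minkowskiSq y = 0 → 0 ≤ y ⬝ᵥ (qMatrix Φ 0 *ᵥ y) := by
    intro y h0 hy
    have h := hpos _ ((Herm2.nonneg_ofCoord_iff y).mpr ⟨h0, hy.ge⟩)
    rw [map_ofCoord, Herm2.nonneg_ofCoord_iff] at h
    rw [← qForm_ofCoord, qForm, map_ofCoord, Herm2.det_ofCoord]
    linarith [h.2]
  rcases le_total 0 (x 0) with h0 | h0
  · exact key x h0 hx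
  · have := key (-x) (by simpa using h0) (by simpa [minkowskiSq] using hx)
    simpa [mulVec_neg] using this

/-! ### The pencil `K - w η` of a form that is nonnegative on the light cone -/

lemma minkowskiSq_smul (t : ℝ) (x : Fin 4 → ℝ) : minkowskiSq (t • x) = t ^ 2 * minkowskiSq x := by
  simp only [minkowskiSq, Pi.smul_apply, smul_eq_mul]
  ring

lemma minkowskiMetric_mulVec_ne_zero {n : Fin 4 → ℝ} (hn : n ≠ 0) : minkowskiMetric *ᵥ n ≠ 0 := by
  intro h
  apply hn
  rw [← one_mulVec n, ← minkowskiMetric_mul_self, ← mulVec_mulVec, h, mulVec_zero]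

lemma dotProduct_pencil_mulVec (K : Matrix (Fin 4) (Fin 4) ℝ) (w : ℝ) (x : Fin 4 → ℝ) :
    x ⬝ᵥ ((K - w • minkowskiMetric) *ᵥ x) = x ⬝ᵥ (K *ᵥ x) - w * minkowskiSq x := by
  rw [sub_mulVec, dotProduct_sub, smul_mulVec, dotProduct_smul, smul_eq_mul, minkowskiSq_eq]

/-- If a quadratic form is nonnegative on null vectors, then its quotient by the Minkowski form is
larger at time-like vectors than at space-like ones. The plane spanned by `x` and `y` contains two
null vectors `x + t₁ y` and `x + t₂ y` with `t₁ < 0 < t₂`; a positive combination of the values of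
the form at these vectors is free of the mixed term. -/
lemma spacelike_quotient_le_timelike_quotient {K : Matrix (Fin 4) (Fin 4) ℝ} (hK : K.IsHermitian)
    (hnull : ∀ x, minkowskiSq x = 0 → 0 ≤ x ⬝ᵥ (K *ᵥ x)) {x y : Fin 4 → ℝ}
    (hx : 0 < minkowskiSq x) (hy : minkowskiSq y < 0) :
    y ⬝ᵥ (K *ᵥ y) / minkowskiSq y ≤ x ⬝ᵥ (K *ᵥ x) / minkowskiSq x := by
  have hη := dotProduct_mulVec_add_smul minkowskiMetric_isHermitian x y
  have hk := dotProduct_mulVec_add_smul hK x y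
  simp only [← minkowskiSq_eq] at hη
  set a := minkowskiSq x
  set c := minkowskiSq y
  set b := x ⬝ᵥ (minkowskiMetric *ᵥ y)
  set A := x ⬝ᵥ (K *ᵥ x)
  set B := x ⬝ᵥ (K *ᵥ y)
  set C := y ⬝ᵥ (K *ᵥ y)
  have hc : c ≠ 0 := hy.ne
  have hd : 0 < b ^ 2 - a * c := by nlinarith [sq_nonneg b, mul_pos hx (neg_pos.mpr hy)]
  obtain ⟨s, hs, hs2⟩ : ∃ s : ℝ, 0 < s ∧ s ^ 2 = b ^ 2 - a * c :=
    ⟨_, Real.sqrt_pos.mpr hd, Real.sq_sqrt hd.le⟩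
  have h1 : 0 ≤ A + 2 * ((-b + s) / c) * B + ((-b + s) / c) ^ 2 * C := by
    rw [← hk]
    apply hnull
    rw [hη]
    field_simp
    linear_combination hs2
  have h2 : 0 ≤ A + 2 * ((-b - s) / c) * B + ((-b - s) / c) ^ 2 * C := by
    rw [← hk]
    apply hnull
    rw [hη]
    field_simp
    linear_combination hs2
  have hbs : |b| < s := abs_lt_of_sq_lt_sq (by nlinarith [mul_pos hx (neg_pos.mpr hy)]) hs.le
  obtain ⟨hb1, hb2⟩ := abs_lt.mp hbs
  have h3 : 0 ≤ (s + b) * (A + 2 * ((-b + s) / c) * B + ((-b + s) / c) ^ 2 * C) +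
      (s - b) * (A + 2 * ((-b - s) / c) * B + ((-b - s) / c) ^ 2 * C) :=
    add_nonneg (mul_nonneg (by linarith) h1) (mul_nonneg (by linarith) h2)
  have h4 : (s + b) * (A + 2 * ((-b + s) / c) * B + ((-b + s) / c) ^ 2 * C) +
      (s - b) * (A + 2 * ((-b - s) / c) * B + ((-b - s) / c) ^ 2 * C)
      = 2 * s * (A - a / c * C) := by
    field_simp
    linear_combination (2 * s * C) * hs2
  rw [h4] at h3
  have h5 : 0 ≤ A - a / c * C := by
    by_contra! h
    nlinarith
  rw [le_div_iff₀ hx]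
  calc C / c * a = a / c * C := by ring
    _ ≤ A := by linarith

/-- Existence of the parameter: `w` is the supremum of `K y / (y · y)` over space-like `y`. If no
kernel vector of `K - w η` were space-like or light-like, then, by compactness, the quotients would
stay away from their supremum. -/
theorem exists_posSemidef_pencil {K : Matrix (Fin 4) (Fin 4) ℝ} (hK : K.IsHermitian)
    (hnull : ∀ x, minkowskiSq x = 0 → 0 ≤ x ⬝ᵥ (K *ᵥ x)) :
    ∃ w : ℝ, (K - w • minkowskiMetric).PosSemidef ∧
      ∃ n, n ≠ 0 ∧ (K - w • minkowskiMetric) *ᵥ n = 0 ∧ minkowskiSq n ≤ 0 := by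
  set A : Set ℝ := {r | ∃ y, minkowskiSq y < 0 ∧ r = y ⬝ᵥ (K *ᵥ y) / minkowskiSq y}
  have he0 : 0 < minkowskiSq ![1, 0, 0, 0] := by simp [minkowskiSq]
  have he1 : minkowskiSq ![0, 1, 0, 0] < 0 := by simp [minkowskiSq]
  have hub : ∀ x, 0 < minkowskiSq x → ∀ r ∈ A, r ≤ x ⬝ᵥ (K *ᵥ x) / minkowskiSq x := by
    rintro x hx r ⟨y, hy, rfl⟩
    exact spacelike_quotient_le_timelike_quotient hK hnull hx hy
  have hne : A.Nonempty := ⟨_, _, he1, rfl⟩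
  have hbdd : BddAbove A := ⟨_, hub _ he0⟩
  set w := sSup A
  have hpsd : (K - w • minkowskiMetric).PosSemidef := by
    refine posSemidef_iff_dotProduct_mulVec.mpr ⟨hK.sub ?_, fun x => ?_⟩
    · rw [IsHermitian, conjTranspose_smul, minkowskiMetric_isHermitian.eq, star_trivial]
    · rw [star_trivial, dotProduct_pencil_mulVec]
      rcases lt_trichotomy (minkowskiSq x) 0 with hx | hx | hx
      · have := le_csSup hbdd (show _ ∈ A from ⟨x, hx, rfl⟩)
        rw [div_le_iff_of_neg hx] at this
        linarith
      · have := hnull x hx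
        rw [hx]
        linarith
      · have := csSup_le hne (hub x hx)
        rw [le_div_iff₀ hx] at this
        linarith
  refine ⟨w, hpsd, ?_⟩
  by_contra! hker
  have hcont : Continuous minkowskiSq := by unfold minkowskiSq; fun_prop
  set S : Set (Fin 4 → ℝ) := Metric.sphere 0 1 ∩ {x | minkowskiSq x ≤ 0}
  have hS : IsCompact S := (isCompact_sphere _ _).inter_right (isClosed_le hcont continuous_const)
  have scale : ∀ y : Fin 4 → ℝ, minkowskiSq y < 0 → ‖y‖⁻¹ • y ∈ S ∧ 0 < ‖y‖⁻¹ := by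
    intro y hy
    have hy0 : y ≠ 0 := by
      rintro rfl
      simp [minkowskiSq] at hy
    refine ⟨⟨?_, ?_⟩, inv_pos.mpr (norm_pos_iff.mpr hy0)⟩
    · simp [norm_smul, norm_ne_zero_iff.mpr hy0]
    · show minkowskiSq _ ≤ 0
      rw [minkowskiSq_smul]
      exact mul_nonpos_of_nonneg_of_nonpos (sq_nonneg _) hy.le
  have hfc : Continuous fun x : Fin 4 → ℝ => x ⬝ᵥ ((K - w • minkowskiMetric) *ᵥ x) := by
    simp only [dotProduct, mulVec]
    fun_prop
  obtain ⟨z, hz, hmin⟩ := hS.exists_isMinOn ⟨_, (scale _ he1).1⟩ hfc.continuousOn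
  set δ := z ⬝ᵥ ((K - w • minkowskiMetric) *ᵥ z)
  have hδpos : 0 < δ := by
    have h0 : 0 ≤ δ := by simpa using hpsd.dotProduct_mulVec_nonneg z
    refine lt_of_le_of_ne h0 fun h => ?_
    have hz0 : z ≠ 0 := by
      rintro rfl
      simpa using hz.1
    have hk := (hpsd.dotProduct_mulVec_zero_iff z).mp (by simpa using h.symm)
    exact (hker z hz0 hk).not_ge hz.2
  have hle : w ≤ w - δ / 3 := by
    refine csSup_le hne ?_
    rintro r ⟨y, hy, rfl⟩
    obtain ⟨hyS, hy1⟩ := scale y hy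
    have h1 : δ ≤ (‖y‖⁻¹ • y) ⬝ᵥ ((K - w • minkowskiMetric) *ᵥ (‖y‖⁻¹ • y)) := hmin hyS
    have h2 : -3 ≤ minkowskiSq (‖y‖⁻¹ • y) := by
      have hb : ∀ i, (‖y‖⁻¹ • y) i ^ 2 ≤ 1 := fun i => by
        have := norm_le_pi_norm (‖y‖⁻¹ • y) i
        rw [mem_sphere_zero_iff_norm.mp hyS.1, Real.norm_eq_abs] at this
        exact (sq_le_one_iff_abs_le_one _).mpr this
      have := sq_nonneg ((‖y‖⁻¹ • y) 0)
      unfold minkowskiSq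
      linarith [hb 1, hb 2, hb 3]
    rw [dotProduct_pencil_mulVec, mulVec_smul, dotProduct_smul, smul_dotProduct, minkowskiSq_smul]
      at h1
    rw [minkowskiSq_smul] at h2
    simp only [smul_eq_mul] at h1
    set u := ‖y‖⁻¹
    have hu : 0 < u ^ 2 := by positivity
    rw [div_le_iff_of_neg hy]
    refine le_of_mul_le_mul_left ?_ hu
    nlinarith
  linarith

/-- The reason for the uniqueness of the parameter: if `n` were not time-like, then it would be
annihilated by both members of the pencil, hence by their difference, a multiple of the metric. -/
lemma minkowskiSq_pos_of_mem_ker_pencil_of_lt {K : Matrix (Fin 4) (Fin 4) ℝ} {w w' : ℝ} (h : w < w')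
    (hw : (K - w • minkowskiMetric).PosSemidef) {n : Fin 4 → ℝ} (hn : n ≠ 0)
    (hker : (K - w' • minkowskiMetric) *ᵥ n = 0) : 0 < minkowskiSq n := by
  by_contra! hle
  have h' := dotProduct_pencil_mulVec K w' n
  rw [hker, dotProduct_zero] at h'
  have h0 : n ⬝ᵥ ((K - w • minkowskiMetric) *ᵥ n) = 0 := by
    have h1 : 0 ≤ n ⬝ᵥ ((K - w • minkowskiMetric) *ᵥ n) := by
      simpa using hw.dotProduct_mulVec_nonneg n
    refine le_antisymm ?_ h1
    rw [dotProduct_pencil_mulVec]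
    nlinarith
  have h2 := (hw.dotProduct_mulVec_zero_iff n).mp (by simpa using h0)
  rw [sub_mulVec, smul_mulVec] at h2 hker
  have h3 : (w' - w) • (minkowskiMetric *ᵥ n) = 0 := by
    rw [sub_smul, ← sub_eq_zero.mp h2, ← sub_eq_zero.mp hker, sub_self]
  exact minkowskiMetric_mulVec_ne_zero hn
    ((smul_eq_zero.mp h3).resolve_left (sub_pos.mpr h).ne')

/-! ### The eigenvalues of `η S` for a positive semidefinite `S` -/

/-- A real symmetric matrix indexed by `Fin n` has an orthonormal family of eigenvectors, expressed
by dot products, whose eigenvalues are listed in decreasing order. -/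
lemma Matrix.IsHermitian.exists_antitone_eigenvalues {n : ℕ} {A : Matrix (Fin n) (Fin n) ℝ}
    (hA : A.IsHermitian) :
    ∃ (μ : Fin n → ℝ) (v : Fin n → Fin n → ℝ), Antitone μ ∧ (∀ i, A *ᵥ v i = μ i • v i) ∧
      (∀ i j, v i ⬝ᵥ v j = if i = j then 1 else 0) ∧ (∀ x, x = ∑ i, (v i ⬝ᵥ x) • v i) ∧
      A.charpoly = ∏ i, (Polynomial.X - Polynomial.C (μ i)) := by
  let e : Fin (Fintype.card (Fin n)) ≃ Fin n := Fintype.equivOfCardEq (Fintype.card_fin _)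
  let σ : Fin n ≃ Fin n := (finCongr (Fintype.card_fin n).symm).trans e
  let b := hA.eigenvectorBasis.reindex σ.symm
  have hb : ∀ i, b i = hA.eigenvectorBasis (σ i) := fun i => by simp [b]
  have hin : ∀ x y : EuclideanSpace ℝ (Fin n), inner ℝ x y = x.ofLp ⬝ᵥ y.ofLp := fun x y => by
    rw [EuclideanSpace.inner_eq_star_dotProduct, star_trivial, dotProduct_comm]
  refine ⟨fun i => hA.eigenvalues (σ i), fun i => (b i).ofLp, ?_, ?_, ?_, ?_, ?_⟩
  · intro i j hij
    have h : ∀ i, hA.eigenvalues (σ i) = hA.eigenvalues₀ (finCongr (Fintype.card_fin n).symm i) :=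
      fun i => congrArg hA.eigenvalues₀ (e.symm_apply_apply _)
    simp only [h]
    exact hA.eigenvalues₀_antitone hij
  · intro i
    simp only [hb]
    exact hA.mulVec_eigenvectorBasis _
  · intro i j
    rw [← hin]
    exact orthonormal_iff_ite.mp b.orthonormal i j
  · intro x
    have h := congrArg WithLp.ofLp (b.sum_repr' (WithLp.toLp 2 x))
    simp only [hin, WithLp.ofLp_sum, WithLp.ofLp_smul] at h
    exact h.symm
  · rw [hA.charpoly_eq]
    exact (Equiv.prod_comp σ fun i => Polynomial.X - Polynomial.C (hA.eigenvalues i)).symm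

/-- The range of a real symmetric matrix is the orthogonal complement of its kernel. -/
lemma Matrix.IsHermitian.exists_mulVec_eq {n : ℕ} {R : Matrix (Fin n) (Fin n) ℝ}
    (hR : R.IsHermitian) {u : Fin n → ℝ} (hu : ∀ x, R *ᵥ x = 0 → x ⬝ᵥ u = 0) :
    ∃ x, R *ᵥ x = u := by
  have hT := isSymmetric_toEuclideanLin_iff.mpr hR
  have h : WithLp.toLp 2 u ∈ (LinearMap.ker (toEuclideanLin R))ᗮ := by
    rw [Submodule.mem_orthogonal]
    intro y hy
    rw [EuclideanSpace.inner_eq_star_dotProduct, star_trivial, dotProduct_comm]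
    apply hu
    have := congrArg WithLp.ofLp (LinearMap.mem_ker.mp hy)
    simpa using this
  rw [← hT.orthogonal_range, Submodule.orthogonal_orthogonal] at h
  obtain ⟨y, hy⟩ := h
  exact ⟨y.ofLp, by simpa using congrArg WithLp.ofLp hy⟩

/-- The Minkowski form of a product `R x` with a symmetric matrix `R`. -/
lemma minkowskiSq_mulVec {R : Matrix (Fin 4) (Fin 4) ℝ} (hR : R.IsHermitian) (x : Fin 4 → ℝ) :
    minkowskiSq (R *ᵥ x) = x ⬝ᵥ ((R * minkowskiMetric * R) *ᵥ x) := by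
  have hRt : Rᵀ = R := by simpa [conjTranspose_eq_transpose_of_trivial] using hR.eq
  rw [minkowskiSq_eq, ← mulVec_mulVec, ← mulVec_mulVec, dotProduct_mulVec x R,
    ← mulVec_transpose, hRt]

/-- If `S` is positive semidefinite with a space-like or light-like kernel vector, then `η S` has
four real eigenvalues, and the second largest is zero.

With `R = √S`, the matrix `η S` has the eigenvalues of the symmetric matrix `R η R`. Since the
Minkowski form is not positive definite on any plane, at most one of them is positive. If all are
nonpositive, then a nonzero vector `R x` that is not space-like and is orthogonal to the kernel
vector shows that the eigenvalue zero is not simple. -/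
theorem exists_charpoly_minkowskiMetric_mul {S : Matrix (Fin 4) (Fin 4) ℝ} (hS : S.PosSemidef)
    {n : Fin 4 → ℝ} (hn : n ≠ 0) (hker : S *ᵥ n = 0) (hle : minkowskiSq n ≤ 0) :
    ∃ μ : Fin 4 → ℝ, Antitone μ ∧ μ 1 = 0 ∧
      (minkowskiMetric * S).charpoly = ∏ i, (Polynomial.X - Polynomial.C (μ i)) := by
  obtain ⟨R, hR, hRS⟩ : ∃ R : Matrix (Fin 4) (Fin 4) ℝ, R.IsHermitian ∧ R * R = S := by
    open scoped MatrixOrder in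
    exact ⟨CFC.sqrt S, (CFC.sqrt_nonneg S).posSemidef.isHermitian,
      CFC.sqrt_mul_sqrt_self S hS.nonneg⟩
  have hRt : Rᵀ = R := by simpa [conjTranspose_eq_transpose_of_trivial] using hR.eq
  have hRker : ∀ x, S *ᵥ x = 0 → R *ᵥ x = 0 := by
    intro x hx
    rw [← hRS, ← mulVec_mulVec] at hx
    have : (R *ᵥ x) ⬝ᵥ (R *ᵥ x) = 0 := by
      rw [dotProduct_comm, ← dotProduct_zero x, ← hx, dotProduct_mulVec x R, ← mulVec_transpose,
        hRt]
    exact dotProduct_self_eq_zero.mp this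
  have hRn := hRker n hker
  set A := R * minkowskiMetric * R with hAdef
  have hA : A.IsHermitian := by
    have := isHermitian_conjTranspose_mul_mul R minkowskiMetric_isHermitian
    rwa [hR.eq] at this
  have hAform : ∀ x, minkowskiSq (R *ᵥ x) = x ⬝ᵥ (A *ᵥ x) := minkowskiSq_mulVec hR
  have hAn : A *ᵥ n = 0 := by rw [hAdef, ← mulVec_mulVec, hRn, mulVec_zero]
  obtain ⟨μ, v, hμ, hv, horth, hexp, hchar⟩ := hA.exists_antitone_eigenvalues
  -- A kernel vector of `A` is orthogonal to the eigenvectors with nonzero eigenvalue.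
  have hcomp : ∀ x, A *ᵥ x = 0 → ∀ i, μ i ≠ 0 → v i ⬝ᵥ x = 0 := by
    intro x hx i hi
    have hAt : Aᵀ = A := by simpa [conjTranspose_eq_transpose_of_trivial] using hA.eq
    have h1 : (A *ᵥ v i) ⬝ᵥ x = 0 := by
      rw [← hAt, mulVec_transpose, ← dotProduct_mulVec, hx, dotProduct_zero]
    rw [hv, smul_dotProduct, smul_eq_mul] at h1
    exact (mul_eq_zero.mp h1).resolve_left hi
  have h01 : μ 1 ≤ μ 0 := hμ (by decide)
  have h12 : μ 2 ≤ μ 1 := hμ (by decide)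
  have h23 : μ 3 ≤ μ 2 := hμ (by decide)
  have hμ1 : μ 1 ≤ 0 := by
    by_contra! hpos
    -- The coefficients are chosen so that the time component of `R x` vanishes.
    set a := (R *ᵥ v 1) 0
    set b := (R *ᵥ v 0) 0
    set x := a • v 0 - b • v 1 with hx
    have h0 : (R *ᵥ x) 0 = 0 := by
      simp only [hx, mulVec_sub, mulVec_smul, Pi.sub_apply, Pi.smul_apply, smul_eq_mul, a, b]
      ring
    have hle0 : minkowskiSq (R *ᵥ x) ≤ 0 := by
      rw [minkowskiSq, h0]
      nlinarith [sq_nonneg ((R *ᵥ x) 1), sq_nonneg ((R *ᵥ x) 2), sq_nonneg ((R *ᵥ x) 3)]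
    have hval : minkowskiSq (R *ᵥ x) = a ^ 2 * μ 0 + b ^ 2 * μ 1 := by
      rw [hAform, hx, mulVec_sub, mulVec_smul, mulVec_smul, hv, hv]
      simp only [sub_dotProduct, dotProduct_sub, smul_dotProduct, dotProduct_smul, horth,
        smul_eq_mul]
      norm_num
      ring
    have ha : a = 0 := by
      by_contra h
      have := mul_pos (pow_pos (abs_pos.mpr h) 2) (hpos.trans_le h01)
      rw [sq_abs] at this
      nlinarith [mul_nonneg (sq_nonneg b) hpos.le]
    -- Then `R (v 1)` itself has no time component.
    have h1 : minkowskiSq (R *ᵥ v 1) = μ 1 := by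
      rw [hAform, hv, dotProduct_smul, horth]
      simp
    rw [minkowskiSq, show (R *ᵥ v 1) 0 = 0 from ha] at h1
    nlinarith [sq_nonneg ((R *ᵥ v 1) 1), sq_nonneg ((R *ᵥ v 1) 2), sq_nonneg ((R *ᵥ v 1) 3)]
  refine ⟨μ, hμ, ?_,
    by rw [← hRS, ← Matrix.mul_assoc, charpoly_mul_comm, ← Matrix.mul_assoc, hchar]⟩
  by_contra hne
  have hneg : μ 1 < 0 := lt_of_le_of_ne hμ1 hne
  -- All kernel vectors of `A` are multiples of `v 0`, hence of `n`.
  have hspan : ∀ x, A *ᵥ x = 0 → x = (v 0 ⬝ᵥ x) • v 0 := by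
    intro x hx
    have h := hexp x
    rw [Fin.sum_univ_four, hcomp x hx 1 hneg.ne, hcomp x hx 2 (by linarith),
      hcomp x hx 3 (by linarith)] at h
    simpa using h
  have hμ0 : μ 0 = 0 := by
    by_contra h
    apply hn
    rw [hspan n hAn, hcomp n hAn 0 h, zero_smul]
  have hnsd : ∀ i, μ i ≤ 0 := fun i => hμ0 ▸ hμ (Fin.zero_le i)
  have hn0 : v 0 ⬝ᵥ n ≠ 0 := fun h => hn (by rw [hspan n hAn, h, zero_smul])
  have hRv : R *ᵥ v 0 = 0 := by
    rw [hspan n hAn, mulVec_smul] at hRn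
    exact (smul_eq_zero.mp hRn).resolve_left hn0
  have hRA : ∀ x, A *ᵥ x = 0 → R *ᵥ x = 0 := fun x hx => by
    rw [hspan x hx, mulVec_smul, hRv, smul_zero]
  -- `u` is orthogonal to `n`, and it is not space-like.
  set m := n 1 ^ 2 + n 2 ^ 2 + n 3 ^ 2 with hm
  have hmn : n 0 ^ 2 ≤ m := by rw [minkowskiSq] at hle; linarith
  have hmpos : 0 < m := by
    by_contra! h
    apply hn
    ext i
    have h0 : n 0 ^ 2 ≤ 0 := by linarith
    fin_cases i <;> refine pow_eq_zero_iff (two_ne_zero) |>.mp (le_antisymm ?_ (sq_nonneg _)) <;>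
      simp <;> nlinarith [sq_nonneg (n 1), sq_nonneg (n 2), sq_nonneg (n 3)]
  set u : Fin 4 → ℝ := ![m, -(n 0 * n 1), -(n 0 * n 2), -(n 0 * n 3)] with hu
  have hun : n ⬝ᵥ u = 0 := by
    simp [hu, dotProduct, Fin.sum_univ_four, hm]
    ring
  have huu : 0 ≤ minkowskiSq u := by
    have : minkowskiSq u = m * (m - n 0 ^ 2) := by
      simp [hu, minkowskiSq, hm]
      ring
    rw [this]
    exact mul_nonneg hmpos.le (by linarith)
  obtain ⟨x, hx⟩ := hR.exists_mulVec_eq (u := u) (by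
    intro y hy
    have hyA : A *ᵥ y = 0 := by rw [hAdef, ← mulVec_mulVec, hy, mulVec_zero]
    have h0 : v 0 ⬝ᵥ u = 0 := by
      rw [hspan n hAn, smul_dotProduct, smul_eq_mul] at hun
      exact (mul_eq_zero.mp hun).resolve_left hn0
    rw [hspan y hyA, smul_dotProduct, h0, smul_zero])
  -- `A` is negative semidefinite, so `x` lies in its kernel, and `u = R x = 0`.
  have hnegA : (-A).PosSemidef := by
    refine posSemidef_iff_dotProduct_mulVec.mpr ⟨hA.neg, fun y => ?_⟩
    have hyA : A *ᵥ y = ∑ i, (v i ⬝ᵥ y) • (μ i • v i) := by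
      conv_lhs => rw [hexp y, mulVec_sum]
      simp only [mulVec_smul, hv]
    rw [star_trivial, neg_mulVec, dotProduct_neg, hyA, dotProduct_sum, ← Finset.sum_neg_distrib]
    refine Finset.sum_nonneg fun i _ => ?_
    rw [dotProduct_smul, dotProduct_smul, dotProduct_comm y, smul_eq_mul, smul_eq_mul]
    nlinarith [hnsd i, mul_self_nonneg (v i ⬝ᵥ y)]
  have hxA : A *ᵥ x = 0 := by
    have h0 : x ⬝ᵥ ((-A) *ᵥ x) = 0 := by
      refine le_antisymm ?_ (by simpa using hnegA.dotProduct_mulVec_nonneg x)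
      rw [neg_mulVec, dotProduct_neg, ← hAform, hx]
      linarith
    simpa [neg_mulVec] using (hnegA.dotProduct_mulVec_zero_iff x).mp (by simpa using h0)
  have hu0 := congrFun (hx.symm.trans (hRA x hxA)) 0
  simp [hu] at hu0
  exact hmpos.ne' hu0

/-! ### The spectrum of `η Q₀` -/

/-- An admissible parameter is the second largest eigenvalue of `η Q₀`, as `η Q₀ = w + η Q_w`. -/
lemma IsAdmissibleParameter.exists_roots_charpoly {Φ : Herm2 →ₗ[ℝ] Herm2} {w : ℝ}
    (hw : IsAdmissibleParameter Φ w) :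
    ∃ w₁ w₃ w₄ : ℝ, (minkowskiMetric * qMatrix Φ 0).charpoly.roots = {w₁, w, w₃, w₄} ∧
      w₁ ≥ w ∧ w ≥ w₃ ∧ w₃ ≥ w₄ := by
  obtain ⟨hpsd, -, n, hn, hker, hle⟩ := hw
  obtain ⟨μ, hμ, h1, hchar⟩ := exists_charpoly_minkowskiMetric_mul hpsd hn hker hle
  have hshift : minkowskiMetric * qMatrix Φ 0 =
      minkowskiMetric * qMatrix Φ w - Matrix.scalar (Fin 4) (-w) := by
    rw [qMatrix_eq_sub Φ w, mul_sub, mul_smul_comm, minkowskiMetric_mul_self, Matrix.scalar_apply,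
      ← Matrix.smul_one_eq_diagonal, neg_smul]
    abel
  have hroots : (minkowskiMetric * qMatrix Φ 0).charpoly =
      ∏ i, (Polynomial.X - Polynomial.C (μ i + w)) := by
    rw [hshift, charpoly_sub_scalar, hchar, Polynomial.prod_comp]
    refine Finset.prod_congr rfl fun i _ => ?_
    simp only [Polynomial.sub_comp, Polynomial.X_comp, Polynomial.C_comp, map_neg, map_add]
    ring
  refine ⟨μ 0 + w, μ 2 + w, μ 3 + w, ?_, ?_, ?_, ?_⟩
  · rw [hroots, Polynomial.roots_prod _ _
      (Finset.prod_ne_zero_iff.mpr fun i _ => Polynomial.X_sub_C_ne_zero _)]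
    simp only [Polynomial.roots_X_sub_C, Multiset.bind_singleton]
    simp [Fin.univ_succ, h1]
  · have := hμ (show (0 : Fin 4) ≤ 1 by decide)
    linarith
  · have := hμ (show (1 : Fin 4) ≤ 2 by decide)
    linarith
  · have := hμ (show (2 : Fin 4) ≤ 3 by decide)
    linarith

/-! ### The concurrence -/

/-- If `Q_w` is positive semidefinite, then `√q_w` is the norm of a linear map. -/
lemma exists_norm_eq_sqrt_qForm {Φ : Herm2 →ₗ[ℝ] Herm2} {w : ℝ}
    (hw : (qMatrix Φ w).PosSemidef) :
    ∃ T : Herm2 →ₗ[ℝ] EuclideanSpace ℝ (Fin 4), ∀ ρ, ‖T ρ‖ = √(qForm Φ w ρ) := by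
  obtain ⟨B, hB⟩ : ∃ B : Matrix (Fin 4) (Fin 4) ℝ, qMatrix Φ w = star B * B := by
    open scoped MatrixOrder in
    exact CStarAlgebra.nonneg_iff_eq_star_mul_self.mp hw.nonneg
  refine ⟨toEuclideanLin B ∘ₗ (WithLp.linearEquiv 2 ℝ (Fin 4 → ℝ)).symm.toLinearMap ∘ₗ
    Herm2.coordEquiv.symm.toLinearMap, fun ρ => ?_⟩
  obtain ⟨x, rfl⟩ := Herm2.ofCoord_surjective ρ
  rw [qForm_ofCoord, hB, star_eq_conjTranspose, conjTranspose_eq_transpose_of_trivial,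
    ← mulVec_mulVec, dotProduct_mulVec x, vecMul_transpose, EuclideanSpace.norm_eq]
  congr 1
  simp [dotProduct, Herm2.coord_ofCoord, sq]

/-- The line through a state `x` of the Bloch ball and a point `n` outside the open ball (or with
direction `n`, if `n 0 = 0`) meets the sphere in two points with `x` between them, and neither of
them lies beyond `n`. Points of the line are written as `c x + t n` with `c + t n₀ = 1`. -/
lemma exists_null_decomposition {x n : Fin 4 → ℝ} (hx0 : x 0 = 1) (hx : 0 < minkowskiSq x)
    (hn : n ≠ 0) (hle : minkowskiSq n ≤ 0) :
    ∃ p c t : Fin 2 → ℝ, (∀ j, 0 < p j) ∧ ∑ j, p j = 1 ∧ (∀ j, 0 ≤ c j) ∧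
      ∑ j, p j * c j = 1 ∧ ∑ j, p j * t j = 0 ∧
      ∀ j, (c j • x + t j • n) 0 = 1 ∧ minkowskiSq (c j • x + t j • n) = 0 := by
  set d := n - n 0 • x with hd
  have hd0 : d 0 = 0 := by simp [hd, hx0]
  have hline : ∀ t : ℝ, (1 - t * n 0) • x + t • n = x + t • d := by
    intro t
    rw [hd, smul_sub, sub_smul, one_smul, smul_smul]
    abel
  have hD : minkowskiSq d < 0 := by
    by_contra! h
    rw [minkowskiSq, hd0] at h
    have hdz : d = 0 := by
      ext i
      fin_cases i
      · exact hd0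
      all_goals
        simp
        nlinarith [sq_nonneg (d 1), sq_nonneg (d 2), sq_nonneg (d 3)]
    have hnx : n = n 0 • x := sub_eq_zero.mp hdz
    rw [hnx, minkowskiSq_smul] at hle
    have hn0 : n 0 = 0 := by
      by_contra h'
      have := mul_pos (pow_pos (abs_pos.mpr h') 2) hx
      rw [sq_abs] at this
      linarith
    exact hn (by rw [hnx, hn0, zero_smul])
  have hη := dotProduct_mulVec_add_smul minkowskiMetric_isHermitian x d
  simp only [← minkowskiSq_eq] at hη
  set D := minkowskiSq d
  set b := x ⬝ᵥ (minkowskiMetric *ᵥ d)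
  have hprod := mul_pos hx (neg_pos.mpr hD)
  have hdisc : 0 < b ^ 2 - minkowskiSq x * D := by nlinarith [sq_nonneg b]
  obtain ⟨s, hs, hs2⟩ : ∃ s : ℝ, 0 < s ∧ s ^ 2 = b ^ 2 - minkowskiSq x * D :=
    ⟨_, Real.sqrt_pos.mpr hdisc, Real.sq_sqrt hdisc.le⟩
  obtain ⟨hb1, hb2⟩ := abs_lt.mp (abs_lt_of_sq_lt_sq (show b ^ 2 < s ^ 2 by nlinarith) hs.le)
  have hDne : D ≠ 0 := hD.ne
  have hroot : ∀ e : ℝ, e ^ 2 = s ^ 2 → minkowskiSq (x + ((-b + e) / D) • d) = 0 := by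
    intro e he
    rw [hη]
    field_simp
    linear_combination he + hs2
  -- If `z = c x + t n` is a null vector with `z₀ = 1` and `c < 0`, then `t n = z - c x` is the sum
  -- of two vectors of the forward light cone, one of them time-like.
  have hc : ∀ t : ℝ, minkowskiSq (x + t • d) = 0 → 0 ≤ 1 - t * n 0 := by
    intro t ht
    by_contra! hneg
    set z := x + t • d with hz
    have hz0 : z 0 = 1 := by simp [hz, hd0, hx0]
    set c := 1 - t * n 0
    have htn : t • n = z + (-c) • x := by
      rw [hz, ← hline t]
      module
    have h1 := dotProduct_mulVec_add_smul minkowskiMetric_isHermitian z x (-c)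
    rw [← htn, ← minkowskiSq_eq, ← minkowskiSq_eq, ← minkowskiSq_eq, minkowskiSq_smul, ht] at h1
    have h2 : 0 ≤ z ⬝ᵥ (minkowskiMetric *ᵥ x) := by
      have h3 : z ⬝ᵥ (minkowskiMetric *ᵥ x) = 1 - z 1 * x 1 - z 2 * x 2 - z 3 * x 3 := by
        simp [minkowskiMetric, Matrix.mulVec_diagonal, dotProduct, Fin.sum_univ_four, hz0, hx0]
        ring
      rw [h3]
      rw [minkowskiSq, hz0] at ht
      rw [minkowskiSq, hx0] at hx
      nlinarith [sq_nonneg (z 1 - x 1), sq_nonneg (z 2 - x 2), sq_nonneg (z 3 - x 3)]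
    have h4 : 0 < (-c) ^ 2 * minkowskiSq x := mul_pos (pow_pos (by linarith) 2) hx
    have h5 : 0 ≤ 2 * -c * (z ⬝ᵥ (minkowskiMetric *ᵥ x)) := mul_nonneg (by linarith) h2
    nlinarith [mul_nonneg (sq_nonneg t) (neg_nonneg.mpr hle)]
  set t₁ := (-b + s) / D with ht₁
  set t₂ := (-b + -s) / D with ht₂
  have hr₁ := hroot s rfl
  have hr₂ := hroot (-s) (neg_sq s)
  have hpos : 0 < 2 * s := by linarith
  have hps : (s + b) / (2 * s) + (s - b) / (2 * s) = 1 := by field_simp; ring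
  have hpt : (s + b) / (2 * s) * t₁ + (s - b) / (2 * s) * t₂ = 0 := by
    rw [ht₁, ht₂]
    field_simp
    ring
  refine ⟨![(s + b) / (2 * s), (s - b) / (2 * s)], ![1 - t₁ * n 0, 1 - t₂ * n 0], ![t₁, t₂],
    ?_, ?_, ?_, ?_, ?_, ?_⟩
  · simp only [Fin.forall_fin_two]
    exact ⟨div_pos (by linarith) hpos, div_pos (by linarith) hpos⟩
  · simpa [Fin.sum_univ_two] using hps
  · simp only [Fin.forall_fin_two]
    exact ⟨hc _ hr₁, hc _ hr₂⟩
  · simp only [Fin.sum_univ_two, Matrix.cons_val_zero, Matrix.cons_val_one]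
    linear_combination hps - n 0 * hpt
  · simpa [Fin.sum_univ_two] using hpt
  · simp only [Fin.forall_fin_two, Matrix.cons_val_zero, Matrix.cons_val_one, hline]
    exact ⟨⟨by simp [hd0, hx0], hr₁⟩, ⟨by simp [hd0, hx0], hr₂⟩⟩

/-- If the kernel of a seminorm `‖T ·‖` contains a nonzero vector that is not time-like, then every
state is a mixture of two pure states on which the triangle inequality is an equality. For a pure
state both components are the state itself. -/
lemma exists_pureDecomposition_norm_eq {E : Type*} [NormedAddCommGroup E] [NormedSpace ℝ E]
    (T : Herm2 →ₗ[ℝ] E) {n : Fin 4 → ℝ} (hn : n ≠ 0) (hle : minkowskiSq n ≤ 0)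
    (hTn : T (Herm2.ofCoord n) = 0) {ρ : Herm2} (hρ : ρ.IsState) :
    ∃ (p : Fin 2 → ℝ) (π : Fin 2 → Herm2),
      IsPureDecomposition ρ p π ∧ ‖T ρ‖ = ∑ j, p j * ‖T (π j)‖ := by
  obtain ⟨x, rfl⟩ := Herm2.ofCoord_surjective ρ
  obtain ⟨hx0, hx⟩ := (Herm2.isState_ofCoord_iff x).mp hρ
  rcases hx.eq_or_lt with hx | hx
  · refine ⟨fun _ => 1 / 2, fun _ => Herm2.ofCoord x, ⟨fun _ => by norm_num, by simp,
      fun _ => (Herm2.isPure_ofCoord_iff x).mpr ⟨hx0, hx.symm⟩, ?_⟩, ?_⟩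
    · rw [← Finset.sum_smul]
      simp
    · rw [← Finset.sum_mul]
      simp
  · obtain ⟨p, c, t, hp, hp1, hc, hpc, hpt, hz⟩ := exists_null_decomposition hx0 hx hn hle
    refine ⟨p, fun j => c j • Herm2.ofCoord x + t j • Herm2.ofCoord n, ⟨hp, hp1, fun j => ?_, ?_⟩,
      ?_⟩
    · have := (Herm2.isPure_ofCoord_iff _).mpr (hz j)
      rwa [← Herm2.coordEquiv_apply, map_add, map_smul, map_smul] at this
    · simp only [smul_add, smul_smul]
      rw [Finset.sum_add_distrib, ← Finset.sum_smul, ← Finset.sum_smul, hpc, hpt]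
      simp
    · simp only [map_add, map_smul, hTn, smul_zero, add_zero, norm_smul, Real.norm_eq_abs,
        abs_of_nonneg (hc _), ← mul_assoc]
      rw [← Finset.sum_mul, hpc, one_mul]

lemma Herm2.IsPure.det_eq_zero {ρ : Herm2} (h : ρ.IsPure) : ρ.det = 0 := by
  obtain ⟨x, rfl⟩ := Herm2.ofCoord_surjective ρ
  rw [Herm2.det_ofCoord, ((Herm2.isPure_ofCoord_iff x).mp h).2, zero_div]

lemma Herm2.IsPure.isState {ρ : Herm2} (h : ρ.IsPure) : ρ.IsState := by
  obtain ⟨x, rfl⟩ := Herm2.ofCoord_surjective ρ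
  obtain ⟨h0, hx⟩ := (Herm2.isPure_ofCoord_iff x).mp h
  exact (Herm2.isState_ofCoord_iff x).mpr ⟨h0, hx.ge⟩

/-- On pure states `q_w` does not depend on `w`. -/
lemma sqrt_qForm_of_isPure (Φ : Herm2 →ₗ[ℝ] Herm2) (w : ℝ) {ρ : Herm2} (h : ρ.IsPure) :
    √(qForm Φ w ρ) = 2 * √((Φ ρ).det) := by
  rw [qForm, h.det_eq_zero, mul_zero, sub_zero, Real.sqrt_mul (by norm_num),
    show (4 : ℝ) = 2 ^ 2 by norm_num, Real.sqrt_sq (by norm_num)]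

lemma convex_isState : Convex ℝ {ρ : Herm2 | ρ.IsState} := by
  rintro ρ ⟨hρ, hρ1⟩ σ ⟨hσ, hσ1⟩ a b ha hb hab
  refine ⟨?_, ?_⟩
  · exact (hρ.smul ha).add (hσ.smul hb)
  · have htr : (a • ρ + b • σ).tr = a * ρ.tr + b * σ.tr := by
      simp [Herm2.tr, Matrix.trace_fin_two]
      ring
    rw [htr, hρ1, hσ1]
    linarith

/-- The infimum defining the concurrence is attained, with value `√q_w`: by the triangle inequality
`√q_w` is a lower bound, and it is linear on a suitable decomposition with two components. -/
lemma concurrence_eq {Φ : Herm2 →ₗ[ℝ] Herm2} {w : ℝ} (hw : IsAdmissibleParameter Φ w)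
    {ρ : Herm2} (hρ : ρ.IsState) : concurrence Φ ρ = √(qForm Φ w ρ) := by
  obtain ⟨hpsd, -, n, hn, hker, hle⟩ := hw
  obtain ⟨T, hT⟩ := exists_norm_eq_sqrt_qForm hpsd
  have hTn : T (Herm2.ofCoord n) = 0 := by
    rw [← norm_eq_zero, hT, qForm_ofCoord, hker, dotProduct_zero, Real.sqrt_zero]
  refine IsLeast.csInf_eq ⟨?_, ?_⟩
  · obtain ⟨p, π, hdec, h⟩ := exists_pureDecomposition_norm_eq T hn hle hTn hρ
    refine ⟨2, p, π, hdec, ?_⟩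
    rw [← hT, h]
    exact Finset.sum_congr rfl fun j _ => by rw [hT, sqrt_qForm_of_isPure Φ w (hdec.2.2.1 j)]
  · rintro c ⟨k, p, π, ⟨hp, -, hpure, hsum⟩, rfl⟩
    rw [← hT, hsum, map_sum]
    refine (norm_sum_le _ _).trans (Finset.sum_le_sum fun j _ => ?_)
    rw [map_smul, norm_smul, Real.norm_eq_abs, abs_of_pos (hp j), hT,
      sqrt_qForm_of_isPure Φ w (hpure j)]

theorem theorem2 (Φ : Herm2 →ₗ[ℝ] Herm2) (hpos : IsPositiveMap Φ) (htr : IsTracePreserving Φ) :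
    ∃ w₀ : ℝ,
      -- `w₀` is the unique parameter satisfying the conditions
      (IsAdmissibleParameter Φ w₀ ∧ ∀ w : ℝ, IsAdmissibleParameter Φ w → w = w₀) ∧
      -- all four eigenvalues of `η Q₀` are real, and `w₀` is the second largest one
      (∃ w₁ w₃ w₄ : ℝ, (minkowskiMetric * qMatrix Φ 0).charpoly.roots = {w₁, w₀, w₃, w₄} ∧
        w₁ ≥ w₀ ∧ w₀ ≥ w₃ ∧ w₃ ≥ w₄) ∧
      -- formula for the concurrence
      (∀ ρ : Herm2, ρ.IsState → concurrence Φ ρ = √(qForm Φ w₀ ρ)) ∧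
      -- the concurrence is a convex roof
      IsConvexRoof (concurrence Φ) ∧
      -- it is constant along the parallel lines with direction `n`, if `n₀ = 0`, and linear along
      -- the half-lines that emanate from `n`, if `n₀ = 1`
      (∀ n : Fin 4 → ℝ, IsNonTimelikeKernelVector Φ w₀ n →
        (n 0 = 0 → ∀ (ρ : Herm2) (s : ℝ), ρ.IsState → (ρ + s • Herm2.ofCoord n).IsState →
          concurrence Φ (ρ + s • Herm2.ofCoord n) = concurrence Φ ρ) ∧
        (n 0 = 1 → ∀ (ρ : Herm2) (s : ℝ), 0 ≤ s → ρ.IsState →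
          (s • ρ + (1 - s) • Herm2.ofCoord n).IsState →
          concurrence Φ (s • ρ + (1 - s) • Herm2.ofCoord n) = s * concurrence Φ ρ)) ∧
      -- every state has an optimal decomposition with two components
      (∀ ρ : Herm2, ρ.IsState → ∃ (p : Fin 2 → ℝ) (π : Fin 2 → Herm2),
        IsOptimalDecomposition (concurrence Φ) ρ p π) := by
  obtain ⟨w, hpsd, n, hn, hker, hle⟩ := exists_posSemidef_pencil (qMatrix_isHermitian Φ 0)
    fun x hx => dotProduct_qMatrix_mulVec_nonneg hpos hx
  rw [← qMatrix_eq_sub] at hpsd hker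
  have hw : IsAdmissibleParameter Φ w :=
    ⟨hpsd, Matrix.exists_mulVec_eq_zero_iff.mp ⟨n, hn, hker⟩, n, hn, hker, hle⟩
  have hunique : ∀ w', IsAdmissibleParameter Φ w' → w' = w := by
    rintro w' ⟨hpsd', -, n', hn', hker', hle'⟩
    rw [qMatrix_eq_sub] at hpsd' hker' hpsd hker
    rcases lt_trichotomy w' w with h | h | h
    · exact absurd hle (minkowskiSq_pos_of_mem_ker_pencil_of_lt h hpsd' hn hker).not_ge
    · exact h
    · exact absurd hle' (minkowskiSq_pos_of_mem_ker_pencil_of_lt h hpsd hn' hker').not_ge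
  obtain ⟨T, hT⟩ := exists_norm_eq_sqrt_qForm hpsd
  have hTker : ∀ m, qMatrix Φ w *ᵥ m = 0 → T (Herm2.ofCoord m) = 0 := fun m hm => by
    rw [← norm_eq_zero, hT, qForm_ofCoord, hm, dotProduct_zero, Real.sqrt_zero]
  have hC : ∀ ρ : Herm2, ρ.IsState → concurrence Φ ρ = ‖T ρ‖ := fun ρ hρ => by
    rw [concurrence_eq hw hρ, hT]
  have hopt : ∀ ρ : Herm2, ρ.IsState → ∃ (p : Fin 2 → ℝ) (π : Fin 2 → Herm2),
      IsOptimalDecomposition (concurrence Φ) ρ p π := by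
    intro ρ hρ
    obtain ⟨p, π, hdec, h⟩ := exists_pureDecomposition_norm_eq T hn hle (hTker n hker) hρ
    refine ⟨p, π, hdec, ?_⟩
    rw [hC ρ hρ, h]
    exact Finset.sum_congr rfl fun j _ => by rw [hC _ (hdec.2.2.1 j).isState]
  refine ⟨w, ⟨hw, hunique⟩, hw.exists_roots_charpoly, fun ρ hρ => concurrence_eq hw hρ,
    ⟨?_, fun ρ hρ => ⟨2, hopt ρ hρ⟩⟩, ?_, hopt⟩
  · refine ⟨convex_isState, fun ρ hρ σ hσ a b ha hb hab => ?_⟩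
    rw [hC _ hρ, hC _ hσ, hC _ (convex_isState hρ hσ ha hb hab), map_add, map_smul, map_smul]
    refine (norm_add_le _ _).trans_eq ?_
    rw [norm_smul, norm_smul, Real.norm_of_nonneg ha, Real.norm_of_nonneg hb, smul_eq_mul,
      smul_eq_mul]
  · rintro m ⟨-, hm, -⟩
    refine ⟨fun _ ρ s hρ hs => ?_, fun _ ρ s h0 hρ hs => ?_⟩
    · rw [hC _ hρ, hC _ hs, map_add, map_smul, hTker m hm, smul_zero, add_zero]
    · rw [hC _ hρ, hC _ hs, map_add, map_smul, map_smul, hTker m hm, smul_zero, add_zero,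
        norm_smul, Real.norm_of_nonneg h0]
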